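/- For a vector $w=(b,c,d,s,e)\in[0,\infty)^5$ define points of the Euclidean plane as follows. Write $u_\theta=(\cos\theta,\sin\theta)$ and put $$A=(0,0),\quad X=A+u_{0},\quad Y=X+s\,u_{-60^\circ},\quad D=Y+d\,u_{0},\quad Z=Y+c\,u_{-120^\circ},\quad Q=Z+d\,u_{-60^\circ},\quad R=Z+e\,u_{180^\circ}.$$ Let $U$ be the point $A$ rotated counterclockwise by $60^\circ$ about $R$, and let $V$ be the point $Q$ rotated counterclockwise by $60^\circ$ about $D$ (the Simpson points of $RA$ and $DQ$). Let $\mathcal S$ be the set of all $w=(b,c,d,s,e)\in[0,\infty)^5$ such that $$\begin{aligned} I_1:&\quad e+c\ge 1,\\ I_2:&\quad e\le s+c+d+2,\\ I_3:&\quad e\ge 2-c-d+s,\\ I_4:&\quad e\le 3s,\\ I_5:&\quad (2+c^2+3d+2s+3cs+3ds+2s^2)-(2+c+3d+s)\,e\ge 0,\\ I_6:&\quad 2\,(\vec{RD}\cdot\vec{AQ})+|\vec{RD}|\,|\vec{AQ}|\ge 0,\\ I_7:&\quad 2\,(\vec{RV}\cdot\vec{RA})+|\vec{RV}|\,|\vec{RA}|\ge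 0,\\ I_8:&\quad 2\,(\vec{AV}\cdot\vec{AR})+|\vec{AV}|\,|\vec{AR}|\ge 0. \end{aligned}$$ **Lemma.** The set $\mathcal S$ is orthogonally convex, i.e. its intersection with every line parallel to a coordinate axis of $\mathbb R^5$ is an interval (possibly empty). Moreover, for every $w\in\mathcal S$ the $(RA)$-$(DQ)$ type Steiner tree is valid, that is: 1. $R,A,D,Q$, in this clockwise order, form a convex quadrilateral: the cross products $\vec{RA}\times\vec{AD}$, $\vec{AD}\times\vec{DQ}$, $\vec{DQ}\times\vec{QR}$, $\vec{QR}\times\vec{RA}$ are all $\le 0$, and the diagonals $RD$ and $AQ$ meet. (Degenerate quadrilaterals are allowed because edge lengths may vanish; if $b,c,d,s,e>0$, then all four cross products are $<0$.) 2. $\max(\angle UDQ,\angle UQD,\angle VRA,\angle VAR)\le 120^\circ$. 3. The intersection angle of the diagonals is at most $120^\circ$: the angle between $\vec{RD}$ and $\vec{AQ}$, and hence $\angle ROA$ for an intersection point $O$ of the segments $RD$ and $AQ$, is at most $120^\circ$. Here an angle is regarded as being $90^\circ$ if one of its sides has length $0$. -/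

import Mathlib

namespace SteinerRA

noncomputable section

/-- The Euclidean plane. -/
abbrev Plane : Type := EuclideanSpace ℝ (Fin 2)

/-- The unit vector of inclination `θ` (in radians). -/
def dir (θ : ℝ) : Plane := !₂[Real.cos θ, Real.sin θ]

/-- The vector `v` rotated counterclockwise by the angle `θ`. -/
def rot (θ : ℝ) (v : Plane) : Plane :=
  !₂[Real.cos θ * v 0 - Real.sin θ * v 1, Real.sin θ * v 0 + Real.cos θ * v 1]

/-- The cross product `u × v` of two plane vectors. -/
def cross (u v : Plane) : ℝ := u 0 * v 1 - u 1 * v 0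

/-- The Simpson point of the segment `AB`: the point `B` rotated counterclockwise by `60°`
about `A`, that is, the third vertex of the equilateral triangle with vertices `A`, `B`, `U` in
counterclockwise order. -/
def simpson (A B : Plane) : Plane := A + rot (Real.pi / 3) (B - A)

/-- `A`, `B`, `C`, `D`, in this clockwise order, form a convex quadrilateral: there is no left turn
at any vertex, and the diagonals `AC` and `BD` meet. Straight angles and coinciding neighbours are
allowed, since edge lengths are allowed to vanish. -/
structure ConvexQuad (A B C D : Plane) : Prop where
  turn_B : cross (B - A) (C - B) ≤ 0
  turn_C : cross (C - B) (D - C) ≤ 0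
  turn_D : cross (D - C) (A - D) ≤ 0
  turn_A : cross (A - D) (B - A) ≤ 0
  diagonals_meet : (segment ℝ A C ∩ segment ℝ B D).Nonempty

/-- The same with a proper right turn at each of the four vertices: `A`, `B`, `C`, `D`, in this
clockwise order, are the vertices of a nondegenerate convex quadrilateral. -/
structure StrictlyConvexQuad (A B C D : Plane) : Prop where
  turn_B : cross (B - A) (C - B) < 0
  turn_C : cross (C - B) (D - C) < 0
  turn_D : cross (D - C) (A - D) < 0
  turn_A : cross (A - D) (B - A) < 0
  diagonals_meet : (segment ℝ A C ∩ segment ℝ B D).Nonempty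

/-- Validity of the `(AB)`-`(CD)` type Steiner tree, with `U = simpson A B` and
`V = simpson C D`. The intersection angle of the diagonals is the angle of the vectors `AC` and
`BD`; it is the angle `AOB` at the intersection point `O` whenever `O` is neither `A` nor `B`. -/
structure ValidSteinerTree (A B C D : Plane) : Prop where
  convex : ConvexQuad A B C D
  angle_UCD : EuclideanGeometry.angle (simpson A B) C D ≤ 2 * Real.pi / 3
  angle_UDC : EuclideanGeometry.angle (simpson A B) D C ≤ 2 * Real.pi / 3
  angle_VAB : EuclideanGeometry.angle (simpson C D) A B ≤ 2 * Real.pi / 3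
  angle_VBA : EuclideanGeometry.angle (simpson C D) B A ≤ 2 * Real.pi / 3
  angle_diagonals : InnerProductGeometry.angle (C - A) (D - B) ≤ 2 * Real.pi / 3
  angle_AOB : ∀ O ∈ segment ℝ A C ∩ segment ℝ B D,
    EuclideanGeometry.angle A O B ≤ 2 * Real.pi / 3

/-- A set is orthogonally convex if its intersection with every line parallel to a coordinate
axis is an interval (possibly empty). -/
def OrthogonallyConvex {n : ℕ} (S : Set (Fin n → ℝ)) : Prop :=
  ∀ (w : Fin n → ℝ) (i : Fin n), {t : ℝ | Function.update w i t ∈ S}.OrdConnected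

/-! A parameter vector is `w = (b, c, d, s, e)`; the points of the local tree are reached from `A`
along its edges. -/

def ptA : Plane := 0

def ptX : Plane := ptA + dir 0

def ptY (w : Fin 5 → ℝ) : Plane := ptX + w 3 • dir (-(Real.pi / 3))

def ptD (w : Fin 5 → ℝ) : Plane := ptY w + w 2 • dir 0

def ptZ (w : Fin 5 → ℝ) : Plane := ptY w + w 1 • dir (-(2 * Real.pi / 3))

def ptQ (w : Fin 5 → ℝ) : Plane := ptZ w + w 2 • dir (-(Real.pi / 3))

def ptR (w : Fin 5 → ℝ) : Plane := ptZ w + w 4 • dir Real.pi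

/-- The Simpson point of the segment `DQ`. -/
def ptV (w : Fin 5 → ℝ) : Plane := simpson (ptD w) (ptQ w)

/-- The inequalities `I₁`, …, `I₈`. -/
structure Ineqs (w : Fin 5 → ℝ) (c d s e : ℝ) : Prop where
  I1 : 1 ≤ e + c
  I2 : e ≤ s + c + d + 2
  I3 : 2 - c - d + s ≤ e
  I4 : e ≤ 3 * s
  I5 : 0 ≤ (2 + c ^ 2 + 3 * d + 2 * s + 3 * c * s + 3 * d * s + 2 * s ^ 2)
    - (2 + c + 3 * d + s) * e
  I6 : 0 ≤ 2 * inner ℝ (ptD w - ptR w) (ptQ w - ptA) + ‖ptD w - ptR w‖ * ‖ptQ w - ptA‖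
  I7 : 0 ≤ 2 * inner ℝ (ptV w - ptR w) (ptA - ptR w) + ‖ptV w - ptR w‖ * ‖ptA - ptR w‖
  I8 : 0 ≤ 2 * inner ℝ (ptV w - ptA) (ptR w - ptA) + ‖ptV w - ptA‖ * ‖ptR w - ptA‖

/-- The region `𝒮` of all vectors of (nonnegative) edge lengths that satisfy the inequalities. -/
def region : Set (Fin 5 → ℝ) :=
  {w | (∀ i, 0 ≤ w i) ∧ Ineqs w (w 1) (w 2) (w 3) (w 4)}

end

end SteinerRA

namespace SteinerRA

/-! ### Coordinates in the triangular lattice basis -/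

/-! In the basis `dir 0`, `dir (-π / 3)` every point has coordinates affine in `w`, and rotation by
60° is an integer matrix, so inner and cross products become polynomials in c, d, s, e. The norms in
`I6`–`I8` can be eliminated because `I1` fixes the orientation of the vectors involved; what remains
is quadratic (`ineqs_iff`).

Orthogonal convexity is then checked one variable and one polynomial at a time: between two points
of the region each polynomial is affine, monotone or concave in the moving variable, so it is at
least its value at one endpoint.

For validity, the cross products are nonnegative expressions in the edge lengths and `c + e - 1`;
`I2` and `I3` make the angles at D and Q at most 90°, and `I6`–`I8` are the remaining angle bounds.
-/

/-- The vector with coordinates `p`, `q` in the basis `dir 0`, `dir (-π / 3)`. -/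
noncomputable def lat (p q : ℝ) : Plane := !₂[p + q / 2, -(√3 / 2 * q)]

theorem lat_add (p q p' q' : ℝ) : lat p q + lat p' q' = lat (p + p') (q + q') := by
  ext i; fin_cases i <;> simp [lat] <;> ring

theorem lat_sub (p q p' q' : ℝ) : lat p q - lat p' q' = lat (p - p') (q - q') := by
  ext i; fin_cases i <;> simp [lat] <;> ring

theorem smul_lat (t p q : ℝ) : t • lat p q = lat (t * p) (t * q) := by
  ext i; fin_cases i <;> simp [lat] <;> ring

theorem inner_lat (p q p' q' : ℝ) :
    inner ℝ (lat p q) (lat p' q') = p * p' + q * q' + (p * q' + q * p') / 2 := by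
  have h : √3 * √3 = 3 := Real.mul_self_sqrt (by norm_num)
  simp only [lat, PiLp.inner_apply, Fin.sum_univ_two, RCLike.inner_apply, conj_trivial,
    Matrix.cons_val_zero, Matrix.cons_val_one]
  linear_combination q * q' / 4 * h

theorem cross_lat (p q p' q' : ℝ) :
    cross (lat p q) (lat p' q') = -(√3 / 2 * (p * q' - q * p')) := by
  simp only [cross, lat, Matrix.cons_val_zero, Matrix.cons_val_one]
  ring

theorem cross_lat_nonpos {p q p' q' : ℝ} (h : 0 ≤ p * q' - q * p') :
    cross (lat p q) (lat p' q') ≤ 0 := by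
  rw [cross_lat]
  exact neg_nonpos.2 (by positivity)

theorem cross_lat_neg {p q p' q' : ℝ} (h : 0 < p * q' - q * p') :
    cross (lat p q) (lat p' q') < 0 := by
  rw [cross_lat]
  exact neg_neg_of_pos (by positivity)

theorem rot_lat (p q : ℝ) : rot (Real.pi / 3) (lat p q) = lat (p + q) (-p) := by
  have h : √3 * √3 = 3 := Real.mul_self_sqrt (by norm_num)
  ext i
  fin_cases i
  · simp [lat, rot]; linear_combination q / 4 * h
  · simp [lat, rot]; ring

theorem simpson_lat (p q p' q' : ℝ) :
    simpson (lat p q) (lat p' q') = lat (p' + q' - q) (p + q - p') := by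
  rw [simpson, lat_sub, rot_lat, lat_add]
  congr 1 <;> ring

theorem dir_zero : dir 0 = lat 1 0 := by
  ext i; fin_cases i <;> simp [lat, dir]

theorem dir_neg_pi_div_three : dir (-(Real.pi / 3)) = lat 0 1 := by
  ext i; fin_cases i <;> simp [lat, dir]

theorem dir_neg_two_pi_div_three : dir (-(2 * Real.pi / 3)) = lat (-1) 1 := by
  have h : 2 * Real.pi / 3 = Real.pi - Real.pi / 3 := by ring
  ext i
  fin_cases i
  · simp [lat, dir, h]; norm_num
  · simp [lat, dir, h]

theorem dir_pi : dir Real.pi = lat (-1) 0 := by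
  ext i; fin_cases i <;> simp [lat, dir]

theorem ptA_eq : ptA = lat 0 0 := by
  ext i; fin_cases i <;> simp [lat, ptA]

theorem ptY_eq (w : Fin 5 → ℝ) : ptY w = lat 1 (w 3) := by
  simp only [ptY, ptX, ptA_eq, dir_zero, dir_neg_pi_div_three, smul_lat, lat_add]
  congr 1 <;> ring

theorem ptD_eq (w : Fin 5 → ℝ) : ptD w = lat (1 + w 2) (w 3) := by
  simp only [ptD, ptY_eq, dir_zero, smul_lat, lat_add]
  congr 1 <;> ring

theorem ptZ_eq (w : Fin 5 → ℝ) : ptZ w = lat (1 - w 1) (w 3 + w 1) := by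
  simp only [ptZ, ptY_eq, dir_neg_two_pi_div_three, smul_lat, lat_add]
  congr 1 <;> ring

theorem ptQ_eq (w : Fin 5 → ℝ) : ptQ w = lat (1 - w 1) (w 3 + w 1 + w 2) := by
  simp only [ptQ, ptZ_eq, dir_neg_pi_div_three, smul_lat, lat_add]
  congr 1 <;> ring

theorem ptR_eq (w : Fin 5 → ℝ) : ptR w = lat (1 - w 1 - w 4) (w 3 + w 1) := by
  simp only [ptR, ptZ_eq, dir_pi, smul_lat, lat_add]
  congr 1 <;> ring

theorem ptV_eq (w : Fin 5 → ℝ) : ptV w = lat (1 + w 2) (w 3 + w 1 + w 2) := by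
  simp only [ptV, ptD_eq, ptQ_eq, simpson_lat]
  congr 1 <;> ring

/-! ### Angles of at most `120°` -/

/-- If `lat p' q'` is reached from `lat p q` by a clockwise turn of at most `180°`, then the
condition that this turn is at most `120°` is polynomial in the coordinates. -/
theorem two_inner_add_norm_mul_norm_nonneg_iff {p q p' q' : ℝ} (h : 0 ≤ p * q' - q * p') :
    0 ≤ 2 * inner ℝ (lat p q) (lat p' q') + ‖lat p q‖ * ‖lat p' q'‖ ↔
      0 ≤ p * p' + q * q' + p * q' := by
  have hsq : (‖lat p q‖ * ‖lat p' q'‖) ^ 2 =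
      inner ℝ (lat p q) (lat p' q') ^ 2 + 3 / 4 * (p * q' - q * p') ^ 2 := by
    rw [mul_pow, ← real_inner_self_eq_norm_sq, ← real_inner_self_eq_norm_sq]
    simp only [inner_lat]
    ring
  have hx := inner_lat p q p' q'
  have hN : 0 ≤ ‖lat p q‖ * ‖lat p' q'‖ := by positivity
  have hp : p * p' + q * q' + p * q' =
      inner ℝ (lat p q) (lat p' q') + (p * q' - q * p') / 2 := by rw [hx]; ring
  rw [hp]
  generalize ‖lat p q‖ * ‖lat p' q'‖ = N at *
  generalize inner ℝ (lat p q) (lat p' q') = x at *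
  generalize p * q' - q * p' = k at *
  -- With x the inner product, N the product of norms and k the determinant, N² = x² + 3k²/4. So 2x
  -- + N ≥ 0 means x ≥ 0 or |x| ≤ k/2, which for k ≥ 0 is x + k/2 ≥ 0.
  constructor
  · intro h1
    by_contra! h2
    nlinarith
  · intro h1
    by_contra! h2
    nlinarith

theorem angle_le_two_pi_div_three {u v : Plane} (h : 0 ≤ 2 * inner ℝ u v + ‖u‖ * ‖v‖) :
    InnerProductGeometry.angle u v ≤ 2 * Real.pi / 3 := by
  have hcos : Real.cos (2 * Real.pi / 3) = -(1 / 2) := by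
    rw [show 2 * Real.pi / 3 = Real.pi - Real.pi / 3 by ring, Real.cos_pi_sub,
      Real.cos_pi_div_three]
  by_contra! hlt
  have h1 := Real.cos_lt_cos_of_nonneg_of_le_pi (by positivity)
    (InnerProductGeometry.angle_le_pi u v) hlt
  rw [hcos, InnerProductGeometry.cos_angle] at h1
  -- If a vector vanishes, the cosine is a quotient by 0, hence 0: this is the 90° convention.
  rcases (mul_nonneg (norm_nonneg u) (norm_nonneg v)).eq_or_lt with h0 | h0
  · rw [← h0] at h1
    norm_num at h1
  · rw [div_lt_iff₀ h0] at h1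
    linarith

theorem angle_le_two_pi_div_three_of_inner_nonneg {u v : Plane} (h : 0 ≤ inner ℝ u v) :
    InnerProductGeometry.angle u v ≤ 2 * Real.pi / 3 :=
  angle_le_two_pi_div_three (by positivity)

/-- The angle of two diagonals bounds the angle at each of their intersection points. -/
theorem angle_at_intersection_le {A B C D O : Plane}
    (h : InnerProductGeometry.angle (C - A) (D - B) ≤ 2 * Real.pi / 3)
    (hAC : O ∈ segment ℝ A C) (hBD : O ∈ segment ℝ B D) :
    EuclideanGeometry.angle A O B ≤ 2 * Real.pi / 3 := by
  rw [segment_eq_image'] at hAC hBD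
  obtain ⟨t, ht, rfl⟩ := hAC
  obtain ⟨r, hr, hO⟩ := hBD
  have hA : A - (A + t • (C - A)) = -(t • (C - A)) := by abel
  have hB : B - (A + t • (C - A)) = -(r • (D - B)) := by
    simp only at hO
    rw [← hO]; abel
  rw [EuclideanGeometry.angle, vsub_eq_sub, vsub_eq_sub, hA, hB,
    InnerProductGeometry.angle_neg_neg]
  have hpi : Real.pi / 2 ≤ 2 * Real.pi / 3 := by linarith [Real.pi_pos]
  rcases ht.1.eq_or_lt with rfl | ht
  · simpa using hpi
  rcases hr.1.eq_or_lt with rfl | hr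
  · simpa using hpi
  rwa [InnerProductGeometry.angle_smul_left_of_pos _ _ ht,
    InnerProductGeometry.angle_smul_right_of_pos _ _ hr]

/-! ### Polynomial description of the region -/

/-- The inequalities of the region with the norms eliminated. -/
structure PolyIneqs (c d s e : ℝ) : Prop where
  c_nonneg : 0 ≤ c
  d_nonneg : 0 ≤ d
  s_nonneg : 0 ≤ s
  e_nonneg : 0 ≤ e
  I1 : 1 ≤ e + c
  I2 : e ≤ s + c + d + 2
  I3 : 2 - c - d + s ≤ e
  I4 : e ≤ 3 * s
  I5 : 0 ≤ (2 + c ^ 2 + 3 * d + 2 * s + 3 * c * s + 3 * d * s + 2 * s ^ 2)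
    - (2 + c + 3 * d + s) * e
  I6 : 0 ≤ c - c ^ 2 + d + d ^ 2 + e + s * d + s * e + d * e
  I7 : 0 ≤ (c + e) * (c + e - 1) + d * (c + 2 * e - 2 - s)
  I8 : 0 ≤ (1 - c - e) * (1 + d) + (s + c) * (1 + s + c + 2 * d)

section

variable {c d s e : ℝ}

theorem det_RD_AQ_nonneg (hc : 0 ≤ c) (hd : 0 ≤ d) (hs : 0 ≤ s) (he : 0 ≤ e) (h : 1 ≤ e + c) :
    0 ≤ (c + d + e) * (s + c + d) + c * (1 - c) := by
  have h1 : 0 ≤ d * (e + c - 1) := mul_nonneg hd (by linarith)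
  have h2 : 0 ≤ e * (s + c) + (1 + d + s) * (c + d) := by positivity
  linarith

theorem det_RA_RV_nonneg (hc : 0 ≤ c) (hd : 0 ≤ d) (hs : 0 ≤ s) (he : 0 ≤ e) (h : 1 ≤ e + c) :
    0 ≤ (c + d + e) * (s + c) + d * (c + e - 1) := by
  have h1 : 0 ≤ d * (c + e - 1) := mul_nonneg hd (by linarith)
  positivity

theorem det_AV_AR_nonneg (hc : 0 ≤ c) (hd : 0 ≤ d) (hs : 0 ≤ s) (h : 1 ≤ e + c) :
    0 ≤ (1 + d) * (s + c) + (c + e - 1) * (s + c + d) := by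
  have h1 : 0 ≤ (c + e - 1) * (s + c + d) := mul_nonneg (by linarith) (by positivity)
  positivity

end

theorem ineqs_iff {w : Fin 5 → ℝ} (hw : ∀ i, 0 ≤ w i) :
    Ineqs w (w 1) (w 2) (w 3) (w 4) ↔ PolyIneqs (w 1) (w 2) (w 3) (w 4) := by
  have key : ∀ h : 1 ≤ w 4 + w 1,
      (0 ≤ 2 * inner ℝ (ptD w - ptR w) (ptQ w - ptA) + ‖ptD w - ptR w‖ * ‖ptQ w - ptA‖ ↔
        0 ≤ w 1 - w 1 ^ 2 + w 2 + w 2 ^ 2 + w 4 + w 3 * w 2 + w 3 * w 4 + w 2 * w 4) ∧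
      (0 ≤ 2 * inner ℝ (ptV w - ptR w) (ptA - ptR w) + ‖ptV w - ptR w‖ * ‖ptA - ptR w‖ ↔
        0 ≤ (w 1 + w 4) * (w 1 + w 4 - 1) + w 2 * (w 1 + 2 * w 4 - 2 - w 3)) ∧
      (0 ≤ 2 * inner ℝ (ptV w - ptA) (ptR w - ptA) + ‖ptV w - ptA‖ * ‖ptR w - ptA‖ ↔
        0 ≤ (1 - w 1 - w 4) * (1 + w 2) + (w 3 + w 1) * (1 + w 3 + w 1 + 2 * w 2)) := by
    intro h
    -- In `I7` the clockwise turn goes from RA to RV, so the factors are swapped.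
    rw [real_inner_comm (ptA - ptR w), mul_comm ‖ptV w - ptR w‖]
    simp only [ptA_eq, ptD_eq, ptQ_eq, ptR_eq, ptV_eq, lat_sub]
    refine ⟨?_, ?_, ?_⟩
    · rw [two_inner_add_norm_mul_norm_nonneg_iff]
      · ring_nf
      · have := det_RD_AQ_nonneg (hw 1) (hw 2) (hw 3) (hw 4) h
        linarith
    · rw [two_inner_add_norm_mul_norm_nonneg_iff]
      · ring_nf
      · have := det_RA_RV_nonneg (hw 1) (hw 2) (hw 3) (hw 4) h
        linarith
    · rw [two_inner_add_norm_mul_norm_nonneg_iff]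
      · ring_nf
      · have := det_AV_AR_nonneg (hw 1) (hw 2) (hw 3) h
        linarith
  constructor
  · rintro ⟨h1, h2, h3, h4, h5, h6, h7, h8⟩
    obtain ⟨k6, k7, k8⟩ := key h1
    exact ⟨hw 1, hw 2, hw 3, hw 4, h1, h2, h3, h4, h5, k6.1 h6, k7.1 h7, k8.1 h8⟩
  · rintro ⟨_, _, _, _, h1, h2, h3, h4, h5, h6, h7, h8⟩
    obtain ⟨k6, k7, k8⟩ := key h1
    exact ⟨h1, h2, h3, h4, h5, k6.2 h6, k7.2 h7, k8.2 h8⟩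

theorem mem_region_iff (w : Fin 5 → ℝ) :
    w ∈ region ↔ 0 ≤ w 0 ∧ PolyIneqs (w 1) (w 2) (w 3) (w 4) := by
  constructor
  · rintro ⟨hw, h⟩
    exact ⟨hw 0, (ineqs_iff hw).1 h⟩
  · rintro ⟨h0, h⟩
    have hw : ∀ i, 0 ≤ w i := by
      intro i
      fin_cases i
      exacts [h0, h.c_nonneg, h.d_nonneg, h.s_nonneg, h.e_nonneg]
    exact ⟨hw, (ineqs_iff hw).2 h⟩

/-! ### Orthogonal convexity -/

theorem affine_nonneg_of_mem_Icc {x y t : ℝ} (α β : ℝ) (hx : 0 ≤ α + β * x) (hy : 0 ≤ α + β * y)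
    (ht : t ∈ Set.Icc x y) : 0 ≤ α + β * t := by
  rcases le_total 0 β with h | h
  · exact hx.trans (by linarith [mul_le_mul_of_nonneg_left ht.1 h])
  · exact hy.trans (by linarith [mul_le_mul_of_nonpos_left ht.2 h])

namespace PolyIneqs

variable {c d s e x y t : ℝ}

theorem of_mem_Icc_c (hx : PolyIneqs x d s e) (hy : PolyIneqs y d s e) (ht : t ∈ Set.Icc x y) :
    PolyIneqs t d s e := by
  obtain ⟨htx, hty⟩ := ht
  obtain ⟨x0, d0, s0, e0, x1, x2, x3, x4, x5, x6, x7, x8⟩ := hx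
  have y6 := hy.I6
  have htx' : 0 ≤ t - x := sub_nonneg.2 htx
  refine ⟨by linarith, d0, s0, e0, by linarith, by linarith, by linarith, x4, ?_, ?_, ?_, ?_⟩
  -- `I4` makes this difference quotient of `I5` nonnegative.
  · linarith [mul_nonneg htx' (show 0 ≤ t + x + 3 * s - e by linarith)]
  -- `I6` is concave in c with its peak at 1/2: compare with x if t + x ≤ 1, otherwise with y.
  · rcases le_total (t + x) 1 with h | h
    · linarith [mul_nonneg htx' (sub_nonneg.2 h)]
    · linarith [mul_nonneg (sub_nonneg.2 hty) (show 0 ≤ t + y - 1 by linarith)]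
  · linarith [mul_nonneg htx' (show 0 ≤ t + x + 2 * e - 1 + d by linarith)]
  · linarith [mul_nonneg htx' (show 0 ≤ t + x + 2 * s + d by linarith)]

theorem of_mem_Icc_d (hx : PolyIneqs c x s e) (hy : PolyIneqs c y s e) (ht : t ∈ Set.Icc x y) :
    PolyIneqs c t s e := by
  have htx' : 0 ≤ t - x := sub_nonneg.2 ht.1
  obtain ⟨c0, x0, s0, e0, x1, x2, x3, x4, x5, x6, x7, x8⟩ := hx
  have y5 := hy.I5
  have y7 := hy.I7
  have y8 := hy.I8
  refine ⟨c0, by linarith, s0, e0, x1, by linarith, by linarith, x4, ?_, ?_, ?_, ?_⟩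
  · have := affine_nonneg_of_mem_Icc (2 + c ^ 2 + 2 * s + 3 * c * s + 2 * s ^ 2 - (2 + c + s) * e)
      (3 + 3 * s - 3 * e) (by linarith) (by linarith) ht
    linarith
  · linarith [mul_nonneg htx' (show 0 ≤ 1 + t + x + s + e by linarith)]
  · have := affine_nonneg_of_mem_Icc ((c + e) * (c + e - 1)) (c + 2 * e - 2 - s)
      (by linarith) (by linarith) ht
    linarith
  · have := affine_nonneg_of_mem_Icc (1 - c - e + (s + c) * (1 + s + c)) (1 - c - e + 2 * (s + c))
      (by linarith) (by linarith) ht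
    linarith

theorem of_mem_Icc_s (hx : PolyIneqs c d x e) (hy : PolyIneqs c d y e) (ht : t ∈ Set.Icc x y) :
    PolyIneqs c d t e := by
  have htx' : 0 ≤ t - x := sub_nonneg.2 ht.1
  have hty := ht.2
  obtain ⟨c0, d0, x0, e0, x1, x2, x3, x4, x5, x6, x7, x8⟩ := hx
  have y3 := hy.I3
  have y7 := hy.I7
  refine ⟨c0, d0, by linarith, e0, x1, by linarith, by linarith, by linarith, ?_, ?_, ?_, ?_⟩
  -- Nonnegativity of the difference quotient comes from `I2` at x.
  · linarith [mul_nonneg htx' (show 0 ≤ 2 + 3 * c + 3 * d + 2 * (t + x) - e by linarith)]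
  · linarith [mul_nonneg htx' (add_nonneg d0 e0)]
  · linarith [mul_nonneg (sub_nonneg.2 hty) d0]
  · linarith [mul_nonneg htx' (show 0 ≤ 1 + t + x + 2 * c + 2 * d by linarith)]

theorem of_mem_Icc_e (hx : PolyIneqs c d s x) (hy : PolyIneqs c d s y) (ht : t ∈ Set.Icc x y) :
    PolyIneqs c d s t := by
  have htx' : 0 ≤ t - x := sub_nonneg.2 ht.1
  have hty' : 0 ≤ y - t := sub_nonneg.2 ht.2
  obtain ⟨c0, d0, s0, x0, x1, x2, x3, x4, x5, x6, x7, x8⟩ := hx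
  obtain ⟨_, _, _, y0, y1, y2, y3, y4, y5, y6, y7, y8⟩ := hy
  refine ⟨c0, d0, s0, by linarith, by linarith, by linarith, by linarith, by linarith,
    ?_, ?_, ?_, ?_⟩
  · linarith [mul_nonneg hty' (show 0 ≤ 2 + c + 3 * d + s by linarith)]
  · linarith [mul_nonneg htx' (show 0 ≤ 1 + s + d by linarith)]
  · linarith [mul_nonneg htx' (show 0 ≤ 2 * c + t + x - 1 + 2 * d by linarith)]
  · linarith [mul_nonneg hty' (show 0 ≤ 1 + d by linarith)]

end PolyIneqs

theorem orthogonallyConvex_region : OrthogonallyConvex region := by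
  intro w i
  refine ⟨fun x hx y hy t ht => ?_⟩
  simp only [Set.mem_ofPred_eq, mem_region_iff] at hx hy ⊢
  obtain ⟨hx0, hx⟩ := hx
  obtain ⟨hy0, hy⟩ := hy
  fin_cases i
  · exact ⟨le_trans hx0 ht.1, hx⟩
  · exact ⟨hx0, hx.of_mem_Icc_c hy ht⟩
  · exact ⟨hx0, hx.of_mem_Icc_d hy ht⟩
  · exact ⟨hx0, hx.of_mem_Icc_s hy ht⟩
  · exact ⟨hx0, hx.of_mem_Icc_e hy ht⟩

/-! ### Convexity of the quadrilateral and validity of the tree -/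

/-- This is the determinant of the diagonals RD and AQ. It could vanish only for c = d = 0, but then
`I1` gives e ≥ 1 and `I4` gives s > 0. -/
theorem PolyIneqs.area_pos {c d s e : ℝ} (h : PolyIneqs c d s e) :
    0 < e * (s + c) + d * (c + e - 1) + (1 + d + s) * (c + d) := by
  obtain ⟨c0, d0, s0, e0, h1, -, h3, h4, -⟩ := h
  have hd : 0 ≤ d * (c + e - 1) := mul_nonneg d0 (by linarith)
  rcases (add_nonneg c0 d0).eq_or_lt with hcd | hcd
  · have hc : c = 0 := by linarith
    have he : 0 < e := by linarith
    have hs : 0 < s := by linarith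
    positivity
  · positivity

theorem diagonals_meet {w : Fin 5 → ℝ} (h : PolyIneqs (w 1) (w 2) (w 3) (w 4)) :
    (segment ℝ (ptR w) (ptD w) ∩ segment ℝ ptA (ptQ w)).Nonempty := by
  have hpos := h.area_pos
  obtain ⟨c0, d0, s0, e0, h1, -⟩ := h
  rw [ptA_eq, ptR_eq, ptD_eq, ptQ_eq]
  generalize w 1 = c at *
  generalize w 2 = d at *
  generalize w 3 = s at *
  generalize w 4 = e at *
  set m := e * (s + c) + d * (c + e - 1) + (1 + d + s) * (c + d) with hm
  have hce : 0 ≤ c + e - 1 := by linarith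
  have hRAQ : 0 ≤ e * (s + c) + d * (c + e - 1) := by positivity
  have hADQ : 0 ≤ (1 + d + s) * (c + d) := by positivity
  have hRAD : 0 ≤ (c + e - 1) * s + (s + c) * (1 + d) := by positivity
  have hRDQ : 0 ≤ (c + d) * (d + e) := by positivity
  -- The diagonals cut each other in ratios of triangle areas: O divides AQ at RAD / m and RD at RAQ
  -- / m, where RAD + RDQ = RAQ + ADQ = m.
  refine ⟨lat 0 0 + (((c + e - 1) * s + (s + c) * (1 + d)) / m) •
    (lat (1 - c) (s + c + d) - lat 0 0), ?_, ?_⟩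
  · rw [segment_eq_image']
    refine ⟨(e * (s + c) + d * (c + e - 1)) / m, ⟨by positivity, ?_⟩, ?_⟩
    · rw [div_le_one hpos]
      linarith
    · simp only [lat_sub, smul_lat, lat_add]
      congr 1
      · field_simp
        rw [hm]; ring
      · field_simp
        rw [hm]; ring
  · rw [segment_eq_image']
    refine ⟨_, ⟨by positivity, ?_⟩, rfl⟩
    rw [div_le_one hpos]
    linarith

theorem convexQuad_of_mem_region {w : Fin 5 → ℝ} (hw : w ∈ region) :
    ConvexQuad (ptR w) ptA (ptD w) (ptQ w) := by
  have h := ((mem_region_iff w).1 hw).2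
  have hmeet := diagonals_meet h
  obtain ⟨c0, d0, s0, e0, h1, -⟩ := h
  have hce : 0 ≤ w 1 + w 4 - 1 := by linarith
  refine ⟨?_, ?_, ?_, ?_, hmeet⟩ <;> simp only [ptA_eq, ptR_eq, ptD_eq, ptQ_eq, lat_sub] <;>
    apply cross_lat_nonpos
  · have : 0 ≤ (w 1 + w 4 - 1) * w 3 + (w 3 + w 1) * (1 + w 2) := by positivity
    linarith
  · have : 0 ≤ (1 + w 2 + w 3) * (w 1 + w 2) := by positivity
    linarith
  · have : 0 ≤ (w 1 + w 2) * (w 2 + w 4) := by positivity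
    linarith
  · have : 0 ≤ w 4 * (w 3 + w 1) + w 2 * (w 1 + w 4 - 1) := by positivity
    linarith

theorem strictlyConvexQuad_of_mem_region {w : Fin 5 → ℝ} (hw : w ∈ region) (hpos : ∀ i, 0 < w i) :
    StrictlyConvexQuad (ptR w) ptA (ptD w) (ptQ w) := by
  have h := ((mem_region_iff w).1 hw).2
  have hce : 0 ≤ w 1 + w 4 - 1 := by linarith [h.I1]
  have c0 := hpos 1
  have d0 := hpos 2
  have s0 := hpos 3
  have e0 := hpos 4
  refine ⟨?_, ?_, ?_, ?_, diagonals_meet h⟩ <;>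
    simp only [ptA_eq, ptR_eq, ptD_eq, ptQ_eq, lat_sub] <;> apply cross_lat_neg
  · have : 0 < (w 1 + w 4 - 1) * w 3 + (w 3 + w 1) * (1 + w 2) := by positivity
    linarith
  · have : 0 < (1 + w 2 + w 3) * (w 1 + w 2) := by positivity
    linarith
  · have : 0 < (w 1 + w 2) * (w 2 + w 4) := by positivity
    linarith
  · have : 0 < w 4 * (w 3 + w 1) + w 2 * (w 1 + w 4 - 1) := by positivity
    linarith

theorem validSteinerTree_of_mem_region {w : Fin 5 → ℝ} (hw : w ∈ region) :
    ValidSteinerTree (ptR w) ptA (ptD w) (ptQ w) := by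
  obtain ⟨hn, h⟩ := hw
  have hcd : 0 ≤ w 1 + w 2 := add_nonneg (hn 1) (hn 2)
  have hdiag := angle_le_two_pi_div_three h.I6
  refine ⟨convexQuad_of_mem_region ⟨hn, h⟩, ?_, ?_, angle_le_two_pi_div_three h.I7,
    angle_le_two_pi_div_three h.I8, hdiag,
    fun O hO => angle_at_intersection_le hdiag hO.1 hO.2⟩
  -- DQ is c + d times a unit vector; the inner products at D and Q are (c + d) / 2 times the slack
  -- of `I2` and of `I3`.
  · apply angle_le_two_pi_div_three_of_inner_nonneg
    simp only [vsub_eq_sub, ptA_eq, ptR_eq, ptD_eq, ptQ_eq, simpson_lat, lat_sub, inner_lat]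
    linarith [mul_nonneg hcd (sub_nonneg.2 h.I2)]
  · apply angle_le_two_pi_div_three_of_inner_nonneg
    simp only [vsub_eq_sub, ptA_eq, ptR_eq, ptD_eq, ptQ_eq, simpson_lat, lat_sub, inner_lat]
    linarith [mul_nonneg hcd (sub_nonneg.2 h.I3)]

end SteinerRA

theorem mainTheorem11 :
    SteinerRA.OrthogonallyConvex SteinerRA.region ∧
    ∀ w ∈ SteinerRA.region,
      SteinerRA.ValidSteinerTree (SteinerRA.ptR w) SteinerRA.ptA (SteinerRA.ptD w)
        (SteinerRA.ptQ w) ∧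
      ((∀ i, 0 < w i) →
        SteinerRA.StrictlyConvexQuad (SteinerRA.ptR w) SteinerRA.ptA (SteinerRA.ptD w)
          (SteinerRA.ptQ w)) := by
  exact ⟨SteinerRA.orthogonallyConvex_region, fun w hw =>
    ⟨SteinerRA.validSteinerTree_of_mem_region hw,
      SteinerRA.strictlyConvexQuad_of_mem_region hw⟩⟩
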